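/- For positive real numbers $a\ne b$ and real $r$, let $$L_r(a,b)=\Big(\frac{b^r-a^r}{r(b-a)}\Big)^{\frac1{r-1}}\quad(r\neq 0,1),\qquad C_r(a,b)=\Big(\frac{b^r+a^r}{b+a}\Big)^{\frac1{r-1}}\quad(r\neq 1)$$ be the generalized logarithmic mean and the generalized inverse harmonic mean, with the exceptional values defined as the corresponding limits, that is, $$L_0(a,b)=\frac{b-a}{\ln b-\ln a},\qquad L_1(a,b)=\frac1e\Big(\frac{b^b}{a^a}\Big)^{\frac1{b-a}},\qquad C_1(a,b)=\big(b^b a^a\big)^{\frac1{b+a}}.$$ Let $0<r<+\infty$ and $b>a>0$. Then (i) for every $\alpha\in(0,1]$, $\; C_r(a,b)^{\alpha}+C_{-r}(a,b)^{\alpha}>a^{\alpha}+b^{\alpha}$; (ii) for every $\beta\in[0,+\infty)$, $\; C_r(a,b)^{2+\beta}+C_{-r}(a,b)^{2+\beta}<a^{2+\beta}+b^{2+\beta}$; (iii) for every $\beta\in[0,+\infty)$, $\; L_r(a,b)^{1+\beta}+L_{-r}(a,b)^{1+\beta}<a^{1+\beta}+b^{1+\beta}$. -/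

import Mathlib

noncomputable section

/-- The generalized logarithmic mean `L_r(a, b)` of two positive numbers `a`, `b`, for real `r`:
`((b ^ r - a ^ r) / (r * (b - a))) ^ (1 / (r - 1))`, where the removable singularities at
`r = 0`, `r = 1` and `a = b` are filled in by the corresponding limits. -/
def genLogMean (r a b : ℝ) : ℝ :=
  if a = b then a
  else if r = 0 then (b - a) / (Real.log b - Real.log a)
  else if r = 1 then (1 / Real.exp 1) * (b ^ b / a ^ a) ^ (1 / (b - a))
  else ((b ^ r - a ^ r) / (r * (b - a))) ^ (1 / (r - 1))

/-- The generalized inverse harmonic mean `C_r(a, b)` of two positive numbers `a`, `b`, for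
real `r`: `((b ^ r + a ^ r) / (b + a)) ^ (1 / (r - 1))`, where the removable singularity at
`r = 1` is filled in by the corresponding limit. -/
def genInvHarmMean (r a b : ℝ) : ℝ :=
  if r = 1 then (b ^ b * a ^ a) ^ (1 / (b + a))
  else ((b ^ r + a ^ r) / (b + a)) ^ (1 / (r - 1))

end

open Real

/-! Put a = e^(g-u), b = e^(g+u), and let f be log cosh for C, log (sinh x / x) for L. With k = (f
(ru) - f u) / (r² - 1), completed by u f'(u) / 2 at r = 1, the means of orders r and -r are
e^(g+k+kr) and e^(g+k-kr). Comparing sums of γ-th powers therefore means comparing e^(γk) cosh (γkr)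
with cosh (γu). Concavity or convexity of powers carries one exponent γ to all the exponents
required.

For γ = 1, f u - k is compared with f (kr). Cauchy's mean value theorem for x² - f² against f
reduces the sign to the monotonicity of `sqSlope`: strictly decreasing for log cosh, which gives
(i), and increasing for log (sinh x / x), which gives (iii) because x coth x increases.

For (ii), if r ≤ 1 the exponent 1 + r already works, by product-to-sum formulas and the monotonicity
of tanh. If r > 1, the exponent 2 is treated in `exp_mul_cosh_two_mul_lt`, which rests on
`two_mul_sq_lt_log_mul_log`. -/

/-! ### Mean value tools. -/

theorem exists_slope_eq_deriv {f f' : ℝ → ℝ} {a b : ℝ} (hab : a < b)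
    (hf : ∀ x, a ≤ x → x ≤ b → HasDerivAt f (f' x) x) :
    ∃ ξ, a < ξ ∧ ξ < b ∧ f b - f a = f' ξ * (b - a) := by
  obtain ⟨ξ, ⟨h1, h2⟩, h⟩ := exists_hasDerivAt_eq_slope f f' hab
    (fun x hx => (hf x hx.1 hx.2).continuousAt.continuousWithinAt)
    (fun x hx => hf x hx.1.le hx.2.le)
  refine ⟨ξ, h1, h2, ?_⟩
  rw [h, div_mul_cancel₀]
  linarith [sub_pos.2 hab]

theorem strictMonoOn_Ioi_of_hasDerivAt_pos {f f' : ℝ → ℝ}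
    (hf : ∀ x, 0 < x → HasDerivAt f (f' x) x) (hpos : ∀ x, 0 < x → 0 < f' x) :
    StrictMonoOn f (Set.Ioi 0) := by
  intro a ha b _ hab
  have ha' : 0 < a := ha
  obtain ⟨ξ, h1, _, h⟩ := exists_slope_eq_deriv hab fun x hx _ => hf x (ha'.trans_le hx)
  have := mul_pos (hpos ξ (ha'.trans h1)) (sub_pos.2 hab)
  linarith

theorem monotoneOn_Ioi_of_hasDerivAt_nonneg {f f' : ℝ → ℝ}
    (hf : ∀ x, 0 < x → HasDerivAt f (f' x) x) (hpos : ∀ x, 0 < x → 0 ≤ f' x) :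
    MonotoneOn f (Set.Ioi 0) := by
  intro a ha b _ hab
  have ha' : 0 < a := ha
  rcases hab.eq_or_lt with rfl | hab
  · rfl
  obtain ⟨ξ, h1, _, h⟩ := exists_slope_eq_deriv hab fun x hx _ => hf x (ha'.trans_le hx)
  have := mul_nonneg (hpos ξ (ha'.trans h1)) (sub_pos.2 hab).le
  linarith

theorem pos_of_hasDerivAt_pos {f f' : ℝ → ℝ} (hf : ∀ x, HasDerivAt f (f' x) x) (h0 : f 0 = 0)
    (hpos : ∀ x, 0 < x → 0 < f' x) {x : ℝ} (hx : 0 < x) : 0 < f x := by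
  obtain ⟨ξ, h1, _, h⟩ := exists_slope_eq_deriv hx fun x _ _ => hf x
  have := mul_pos (hpos ξ h1) (sub_pos.2 hx)
  linarith

/-! ### Chords in the squared variable and the Cauchy comparison. -/

/-- The derivative of `x ^ 2 - f x ^ 2` with respect to `f x`. -/
noncomputable def sqSlope (f f' : ℝ → ℝ) (x : ℝ) : ℝ := 2 * x / f' x - 2 * f x

theorem exists_sq_sub_sq_eq {f f' : ℝ → ℝ} (hf : ∀ x, 0 < x → HasDerivAt f (f' x) x)
    (hpos : ∀ x, 0 < x → 0 < f' x) {a b : ℝ} (ha : 0 < a) (hab : a < b) :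
    ∃ ξ, a < ξ ∧ ξ < b ∧ b ^ 2 - a ^ 2 = (f b - f a) * (sqSlope f f' ξ + f a + f b) := by
  have hd : ∀ x, 0 < x →
      HasDerivAt (fun x => x ^ 2 - f x ^ 2) (2 * x - 2 * f x * f' x) x := by
    intro x hx
    have := (hasDerivAt_pow 2 x).sub ((hf x hx).pow 2)
    exact this.congr_deriv (by norm_num)
  obtain ⟨ξ, ⟨h1, h2⟩, h⟩ := exists_ratio_hasDerivAt_eq_ratio_slope f f' hab
    (fun x hx => (hf x (ha.trans_le hx.1)).continuousAt.continuousWithinAt)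
    (fun x hx => hf x (ha.trans hx.1)) (fun x => x ^ 2 - f x ^ 2)
    (fun x => 2 * x - 2 * f x * f' x)
    (fun x hx => (hd x (ha.trans_le hx.1)).continuousAt.continuousWithinAt)
    (fun x hx => hd x (ha.trans hx.1))
  refine ⟨ξ, h1, h2, ?_⟩
  have hp := hpos ξ (ha.trans h1)
  have h3 : sqSlope f f' ξ * f' ξ = 2 * ξ - 2 * f ξ * f' ξ := by
    unfold sqSlope; field_simp
  have h4 : (b ^ 2 - f b ^ 2 - (a ^ 2 - f a ^ 2)) = (f b - f a) * sqSlope f f' ξ := by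
    have := hp.ne'
    apply mul_right_cancel₀ this
    rw [mul_assoc, h3]; linarith
  linear_combination h4

/-- `k` is `u ^ 2` times the divided difference of `f`, as a function of the square of its
argument, at `u` and `r * u`, or the corresponding derivative if `r = 1`. -/
structure IsSqChord (f f' : ℝ → ℝ) (u r k : ℝ) : Prop where
  chord : f (r * u) - f u = k * (r ^ 2 - 1)
  confluent : r = 1 → 2 * k = u * f' u
  exists_deriv : ∃ ξ, 0 < ξ ∧ (r ≤ 1 → ξ ≤ u) ∧ k * (r + 1) = u * f' ξ
  exists_sqSlope : ∃ ξ, min u (r * u) ≤ ξ ∧ u ^ 2 = k * (sqSlope f f' ξ + f u + f (r * u))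

theorem IsSqChord.pos {f f' : ℝ → ℝ} {u r k : ℝ} (h : IsSqChord f f' u r k) (hu : 0 < u)
    (hr : 0 < r) (hpos : ∀ x, 0 < x → 0 < f' x) : 0 < k := by
  obtain ⟨ξ, h1, _, h2⟩ := h.exists_deriv
  have : 0 < k * (r + 1) := h2 ▸ mul_pos hu (hpos ξ h1)
  exact pos_of_mul_pos_left this (by linarith)

theorem IsSqChord.lt {f f' : ℝ → ℝ} {u r k : ℝ} (h : IsSqChord f f' u r k) (hu : 0 < u)
    (hlt : ∀ x, 0 < x → f' x < 1) : k + k * r < u := by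
  obtain ⟨ξ, h1, _, h2⟩ := h.exists_deriv
  have := mul_lt_mul_of_pos_left (hlt ξ h1) hu
  linarith

theorem exists_isSqChord {f f' : ℝ → ℝ} (hf : ∀ x, 0 < x → HasDerivAt f (f' x) x)
    (hpos : ∀ x, 0 < x → 0 < f' x) {u r : ℝ} (hu : 0 < u) (hr : 0 < r) :
    ∃ k, IsSqChord f f' u r k := by
  have hv : 0 < r * u := mul_pos hr hu
  rcases lt_trichotomy r 1 with h | rfl | h
  · have hlt : r * u < u := by nlinarith
    have hne : r ^ 2 - 1 ≠ 0 := by nlinarith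
    refine ⟨(f (r * u) - f u) / (r ^ 2 - 1), by field_simp, fun h' => absurd h' h.ne, ?_, ?_⟩
    · obtain ⟨ξ, h1, h2, h3⟩ := exists_slope_eq_deriv hlt fun x hx _ => hf x (hv.trans_le hx)
      refine ⟨ξ, hv.trans h1, fun _ => h2.le, ?_⟩
      have : f (r * u) - f u = f' ξ * u * (r - 1) := by linear_combination -h3
      rw [this]
      have : r - 1 ≠ 0 := by linarith
      field_simp
      ring
    · obtain ⟨ξ, h1, h2, h3⟩ := exists_sq_sub_sq_eq hf hpos hv hlt
      refine ⟨ξ, (min_le_right _ _).trans h1.le, ?_⟩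
      rw [div_mul_eq_mul_div, eq_div_iff hne]
      linear_combination -h3
  · refine ⟨u * f' u / 2, by ring_nf, fun _ => by ring, ⟨u, hu, fun _ => le_rfl, by ring⟩,
      u, min_le_left _ _, ?_⟩
    have := (hpos u hu).ne'
    unfold sqSlope
    field_simp
    ring_nf
  · have hlt : u < r * u := by nlinarith
    have hne : r ^ 2 - 1 ≠ 0 := by nlinarith
    refine ⟨(f (r * u) - f u) / (r ^ 2 - 1), by field_simp, fun h' => absurd h' h.ne', ?_, ?_⟩
    · obtain ⟨ξ, h1, h2, h3⟩ := exists_slope_eq_deriv hlt fun x hx _ => hf x (hu.trans_le hx)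
      refine ⟨ξ, hu.trans h1, fun h' => absurd h' h.not_ge, ?_⟩
      have : f (r * u) - f u = f' ξ * u * (r - 1) := by linear_combination h3
      rw [this]
      have : r - 1 ≠ 0 := by linarith
      field_simp
      ring
    · obtain ⟨ξ, h1, h2, h3⟩ := exists_sq_sub_sq_eq hf hpos hu hlt
      refine ⟨ξ, (min_le_left _ _).trans h1.le, ?_⟩
      rw [div_mul_eq_mul_div, eq_div_iff hne]
      linear_combination h3

/-- Comparison of the chord of `f` with the point `k * r`, as a consequence of Cauchy's mean
value theorem on both sides of the smaller of `u` and `r * u`. -/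
theorem IsSqChord.exists_compare {f f' : ℝ → ℝ} (hf : ∀ x, 0 < x → HasDerivAt f (f' x) x)
    (hpos : ∀ x, 0 < x → 0 < f' x) (hlt : ∀ x, 0 < x → f' x < 1) {u r k : ℝ} (hu : 0 < u)
    (hr : 0 < r) (h : IsSqChord f f' u r k) :
    ∃ K δ P D ξ ζ, 0 < ξ ∧ ξ < ζ ∧ 0 < K ∧ 0 < δ ∧ K ^ 2 < P ∧ δ ^ 2 < P ∧
      δ - K = f u - k - f (k * r) ∧ D = sqSlope f f' ξ - sqSlope f f' ζ ∧
      (δ - K) * (δ * K - P) = δ * K * D := by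
  have hk := h.pos hu hr hpos
  have hv : 0 < r * u := mul_pos hr hu
  have hw : 0 < k * r := mul_pos hk hr
  have hsum := h.lt hu hlt
  -- Here m is the smaller of u and ru, and K is k or k r² accordingly, so that f m - K = f u - k in
  -- both cases. The two slopes are then taken over [kr, m] and between u and ru.
  have key : ∀ m K : ℝ, k * r < m → 0 < K → K ^ 2 < m ^ 2 - (k * r) ^ 2 →
      f m - K = f u - k → min u (r * u) = m →
      (∀ S, u ^ 2 = k * (S + f u + f (r * u)) →
        m ^ 2 - (k * r) ^ 2 + K ^ 2 = K * (S + 2 * f m)) →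
      ∃ K δ P D ξ ζ, 0 < ξ ∧ ξ < ζ ∧ 0 < K ∧ 0 < δ ∧ K ^ 2 < P ∧ δ ^ 2 < P ∧
      δ - K = f u - k - f (k * r) ∧ D = sqSlope f f' ξ - sqSlope f f' ζ ∧
      (δ - K) * (δ * K - P) = δ * K * D := by
    intro m K hm hK hKP hfm hmin hS
    obtain ⟨ξ, h1, h2, h3⟩ := exists_sq_sub_sq_eq hf hpos hw hm
    obtain ⟨ζ, h4, h5⟩ := h.exists_sqSlope
    obtain ⟨η, h6, _, h7⟩ := exists_slope_eq_deriv hm fun x hx _ => hf x (hw.trans_le hx)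
    have hd : 0 < f m - f (k * r) := by
      rw [h7]; exact mul_pos (hpos _ (hw.trans h6)) (sub_pos.2 hm)
    have hd' : f m - f (k * r) < m - k * r := by
      rw [h7]
      have := mul_lt_mul_of_pos_right (hlt _ (hw.trans h6)) (sub_pos.2 hm)
      linarith
    refine ⟨K, f m - f (k * r), m ^ 2 - (k * r) ^ 2, _, ξ, ζ, hw.trans h1,
      h2.trans_le (hmin ▸ h4), hK, hd, hKP, ?_, by linarith, rfl, ?_⟩
    · nlinarith
    · linear_combination K * h3 - (f m - f (k * r)) * hS _ h5
  rcases le_total 1 r with h1 | h1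
  · refine key u k (by linarith) hk (by nlinarith) rfl (min_eq_left (by nlinarith)) ?_
    intro S hS
    linear_combination hS + k * h.chord
  · refine key (r * u) (k * r ^ 2) (by nlinarith) (by positivity) ?_ ?_
      (min_eq_right (by nlinarith)) ?_
    · have : 0 < r ^ 2 * (u ^ 2 - k ^ 2 - (k * r) ^ 2) := mul_pos (by positivity) (by nlinarith)
      nlinarith
    · linear_combination h.chord
    · intro S hS
      linear_combination r ^ 2 * hS - r ^ 2 * k * h.chord

/-- K² and δ² both lie below P, so δK < P, and the identity of `exists_compare` forces δ - K and D
to have opposite signs. -/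
theorem IsSqChord.sub_lt_of_strictAntiOn {f f' : ℝ → ℝ}
    (hf : ∀ x, 0 < x → HasDerivAt f (f' x) x)
    (hpos : ∀ x, 0 < x → 0 < f' x) (hlt : ∀ x, 0 < x → f' x < 1)
    (hanti : StrictAntiOn (sqSlope f f') (Set.Ioi 0)) {u r k : ℝ} (hu : 0 < u)
    (hr : 0 < r) (h : IsSqChord f f' u r k) : f u - k < f (k * r) := by
  obtain ⟨K, δ, P, D, ξ, ζ, h1, h2, hK, hd, hKP, hdP, hdK, hD, e⟩ :=
    h.exists_compare hf hpos hlt hu hr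
  have hDpos : 0 < D := by
    rw [hD]; exact sub_pos.2 (hanti h1 (h1.trans h2) h2)
  have : 0 < δ * K * D := by positivity
  by_contra! hcon
  have h3 : K ≤ δ := by linarith
  nlinarith [mul_nonneg (sub_nonneg.2 h3) (show 0 ≤ P - δ * K by nlinarith)]

theorem IsSqChord.le_sub_of_monotoneOn {f f' : ℝ → ℝ}
    (hf : ∀ x, 0 < x → HasDerivAt f (f' x) x)
    (hpos : ∀ x, 0 < x → 0 < f' x) (hlt : ∀ x, 0 < x → f' x < 1)
    (hmono : MonotoneOn (sqSlope f f') (Set.Ioi 0)) {u r k : ℝ} (hu : 0 < u)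
    (hr : 0 < r) (h : IsSqChord f f' u r k) : f (k * r) ≤ f u - k := by
  obtain ⟨K, δ, P, D, ξ, ζ, h1, h2, hK, hd, hKP, hdP, hdK, hD, e⟩ :=
    h.exists_compare hf hpos hlt hu hr
  have hDnp : D ≤ 0 := by
    rw [hD]; exact sub_nonpos.2 (hmono h1 (h1.trans h2) h2.le)
  have : δ * K * D ≤ 0 := mul_nonpos_of_nonneg_of_nonpos (by positivity) hDnp
  by_contra! hcon
  have h3 : δ < K := by linarith
  nlinarith [mul_pos (sub_pos.2 h3) (show 0 < P - δ * K by nlinarith)]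

/-! ### The function log cosh. -/

theorem sinh_lt_mul_cosh {x : ℝ} (hx : 0 < x) : sinh x < x * cosh x := by
  have hd : ∀ x, HasDerivAt (fun x => x * cosh x - sinh x) (x * sinh x) x := fun x =>
    (((hasDerivAt_id x).mul (hasDerivAt_cosh x)).sub (hasDerivAt_sinh x)).congr_deriv
      (by simp)
  have := pos_of_hasDerivAt_pos hd (by simp) (fun x hx => mul_pos hx (sinh_pos_iff.2 hx)) hx
  linarith

theorem hasDerivAt_log_cosh (x : ℝ) : HasDerivAt (fun x => log (cosh x)) (tanh x) x := by
  rw [tanh_eq_sinh_div_cosh]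
  exact (hasDerivAt_cosh x).log (cosh_pos x).ne'

theorem hasDerivAt_tanh (x : ℝ) : HasDerivAt tanh (1 / cosh x ^ 2) x := by
  have h : tanh = fun x => sinh x / cosh x := funext tanh_eq_sinh_div_cosh
  rw [h]
  refine ((hasDerivAt_sinh x).div (hasDerivAt_cosh x) (cosh_pos x).ne').congr_deriv ?_
  rw [← cosh_sq_sub_sinh_sq x]; ring_nf

theorem strictMono_tanh : StrictMono tanh :=
  strictMono_of_hasDerivAt_pos hasDerivAt_tanh fun x => by positivity

theorem tanh_pos_of_pos {x : ℝ} (hx : 0 < x) : 0 < tanh x := by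
  simpa using strictMono_tanh hx

theorem tanh_lt_self {x : ℝ} (hx : 0 < x) : tanh x < x := by
  rw [tanh_eq_sinh_div_cosh, div_lt_iff₀ (cosh_pos x)]
  exact sinh_lt_mul_cosh hx

theorem strictAntiOn_sqSlope_log_cosh :
    StrictAntiOn (sqSlope (fun x => log (cosh x)) tanh) (Set.Ioi 0) := by
  have hd : ∀ x, 0 < x → HasDerivAt (fun x => -sqSlope (fun x => log (cosh x)) tanh x)
      (2 * (x - tanh x) / sinh x ^ 2) x := by
    intro x hx
    have hs := (sinh_pos_iff.2 hx).ne'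
    have hc := (cosh_pos x).ne'
    have h1 := ((hasDerivAt_id x).const_mul 2).div (hasDerivAt_tanh x) (tanh_pos_of_pos hx).ne'
    have h2 := ((h1.sub ((hasDerivAt_log_cosh x).const_mul 2))).neg
    refine h2.congr_deriv ?_
    have e := cosh_sq x
    simp only [tanh_eq_sinh_div_cosh, id]
    field_simp
    linear_combination -sinh x * e
  have := strictMonoOn_Ioi_of_hasDerivAt_pos hd fun x hx => by
    have h1 := tanh_lt_self hx
    have h2 := sinh_pos_iff.2 hx
    have h3 := sub_pos.2 h1
    positivity
  intro a ha b hb hab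
  have := this ha hb hab
  simpa using this

/-! ### The function log (sinh x / x). -/

theorem hasDerivAt_mul_cosh_sub_sinh (x : ℝ) :
    HasDerivAt (fun x => x * cosh x - sinh x) (x * sinh x) x :=
  (((hasDerivAt_id x).mul (hasDerivAt_cosh x)).sub (hasDerivAt_sinh x)).congr_deriv (by simp)

/-- The derivative of `log (sinh x) - log x`. -/
noncomputable def langevin (x : ℝ) : ℝ := (x * cosh x - sinh x) / (x * sinh x)

theorem hasDerivAt_log_sinh_sub_log {x : ℝ} (hx : 0 < x) :
    HasDerivAt (fun x => log (sinh x) - log x) (langevin x) x := by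
  have hs := (sinh_pos_iff.2 hx).ne'
  refine (((hasDerivAt_sinh x).log hs).sub (hasDerivAt_log hx.ne')).congr_deriv ?_
  unfold langevin
  field_simp

theorem langevin_pos {x : ℝ} (hx : 0 < x) : 0 < langevin x :=
  div_pos (sub_pos.2 (sinh_lt_mul_cosh hx)) (mul_pos hx (sinh_pos_iff.2 hx))

theorem langevin_lt_one {x : ℝ} (hx : 0 < x) : langevin x < 1 := by
  have hs := sinh_pos_iff.2 hx
  unfold langevin
  rw [div_lt_one (mul_pos hx hs)]
  have h1 : cosh x - sinh x = exp (-x) := cosh_sub_sinh x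
  have h2 : exp (-x) < 1 := by rw [exp_lt_one_iff]; linarith
  have h3 := self_lt_sinh_iff.2 hx
  nlinarith

theorem mul_cosh_sub_sinh_lt {x : ℝ} (hx : 0 < x) : x * cosh x - sinh x < x ^ 2 * sinh x := by
  have hd : ∀ x, HasDerivAt (fun x => x ^ 2 * sinh x - (x * cosh x - sinh x))
      (x * sinh x + x ^ 2 * cosh x) x := fun x =>
    (((hasDerivAt_pow 2 x).mul (hasDerivAt_sinh x)).sub
      (hasDerivAt_mul_cosh_sub_sinh x)).congr_deriv (by norm_num; ring)
  have := pos_of_hasDerivAt_pos hd (by simp) (fun x hx => by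
    have := sinh_pos_iff.2 hx
    have := cosh_pos x
    positivity) hx
  linarith

/-- This is the factor that decides the sign of the derivative in `langevin_cubic_nonneg`. -/
theorem langevin_quadratic_pos {x : ℝ} (hx : 0 < x) :
    0 < (x * cosh x - sinh x) ^ 2 + 4 * (x * cosh x - sinh x) * sinh x - x ^ 2 * sinh x ^ 2 := by
  have hd : ∀ x, HasDerivAt (fun x => (x * cosh x - sinh x) ^ 2
        + 4 * (x * cosh x - sinh x) * sinh x - x ^ 2 * sinh x ^ 2)
      (4 * (x * cosh x - sinh x) * cosh x) x := fun x =>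
    ((((hasDerivAt_mul_cosh_sub_sinh x).pow 2).add
      (((hasDerivAt_mul_cosh_sub_sinh x).const_mul 4).mul (hasDerivAt_sinh x))).sub
      ((hasDerivAt_pow 2 x).mul ((hasDerivAt_sinh x).pow 2))).congr_deriv (by norm_num; ring)
  exact pos_of_hasDerivAt_pos hd (by simp) (fun x hx =>
    mul_pos (mul_pos four_pos (sub_pos.2 (sinh_lt_mul_cosh hx))) (cosh_pos x)) hx

/-- Up to a positive factor, this is the derivative of `sqSlope` for log (sinh x / x). It is
increasing and has nonnegative limit at 0+. -/
theorem langevin_cubic_nonneg {x : ℝ} (hx : 0 < x) :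
    0 ≤ (x * cosh x - sinh x) ^ 2 / x + 3 * (x * cosh x - sinh x) * sinh x / x
      - x * sinh x ^ 2 - (x * cosh x - sinh x) ^ 3 / (x ^ 3 * sinh x) := by
  set Q : ℝ → ℝ := fun x => (x * cosh x - sinh x) ^ 2 / x
    + 3 * (x * cosh x - sinh x) * sinh x / x
      - x * sinh x ^ 2 - (x * cosh x - sinh x) ^ 3 / (x ^ 3 * sinh x) with hQ
  have hd : ∀ x, 0 < x → HasDerivAt Q ((x * cosh x - sinh x) ^ 2 *
      ((x * cosh x - sinh x) ^ 2 + 4 * (x * cosh x - sinh x) * sinh x - x ^ 2 * sinh x ^ 2)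
        / (x ^ 4 * sinh x ^ 2)) x := by
    intro x hx
    have hs := (sinh_pos_iff.2 hx).ne'
    have hn := hasDerivAt_mul_cosh_sub_sinh x
    have hsd := hasDerivAt_sinh x
    refine (((((hn.pow 2).div (hasDerivAt_id x) hx.ne').add
      (((hn.const_mul 3).mul hsd).div (hasDerivAt_id x) hx.ne')).sub
      ((hasDerivAt_id x).mul (hsd.pow 2))).sub
      ((hn.pow 3).div ((hasDerivAt_pow 3 x).mul hsd)
        (mul_ne_zero (pow_ne_zero _ hx.ne') hs))).congr_deriv ?_
    simp only [id, Pi.pow_apply, Pi.mul_apply]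
    norm_num
    field_simp
    ring
  have hmono : MonotoneOn Q (Set.Ioi 0) := monotoneOn_Ioi_of_hasDerivAt_nonneg hd fun x hx =>
    div_nonneg (mul_nonneg (sq_nonneg _) (langevin_quadratic_pos hx).le) (by positivity)
  -- Q is a quotient with vanishing denominators at 0, so a continuous minorant tending to 0
  -- replaces its value there.
  have hlow : ∀ y, 0 < y → -(y + y ^ 3) * sinh y ^ 2 ≤ Q y := by
    intro y hy
    have hs := sinh_pos_iff.2 hy
    have hn := sub_pos.2 (sinh_lt_mul_cosh hy)
    have h1 : (y * cosh y - sinh y) ^ 3 / (y ^ 3 * sinh y) ≤ y ^ 3 * sinh y ^ 2 := by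
      rw [div_le_iff₀ (by positivity)]
      calc (y * cosh y - sinh y) ^ 3 ≤ (y ^ 2 * sinh y) ^ 3 :=
            pow_le_pow_left₀ hn.le (mul_cosh_sub_sinh_lt hy).le 3
        _ = _ := by ring
    have h2 : 0 ≤ (y * cosh y - sinh y) ^ 2 / y := by positivity
    have h3 : 0 ≤ 3 * (y * cosh y - sinh y) * sinh y / y := by positivity
    simp only [hQ]
    linarith
  have hlim : Filter.Tendsto (fun y : ℝ => -(y + y ^ 3) * sinh y ^ 2) (nhdsWithin 0 (Set.Ioi 0))
      (nhds 0) := by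
    have : Continuous fun y : ℝ => -(y + y ^ 3) * sinh y ^ 2 := by fun_prop
    exact (this.tendsto' 0 0 (by simp)).mono_left nhdsWithin_le_nhds
  refine le_of_tendsto hlim ?_
  filter_upwards [Ioo_mem_nhdsGT hx] with y hy
  exact (hlow y hy.1).trans (hmono hy.1 hx hy.2.le)

theorem monotoneOn_sqSlope_log_sinh_sub_log :
    MonotoneOn (sqSlope (fun x => log (sinh x) - log x) langevin) (Set.Ioi 0) := by
  have hd : ∀ x, 0 < x → HasDerivAt (sqSlope (fun x => log (sinh x) - log x) langevin)
      (2 * x ^ 2 / (x * cosh x - sinh x) ^ 2 * ((x * cosh x - sinh x) ^ 2 / x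
        + 3 * (x * cosh x - sinh x) * sinh x / x
        - x * sinh x ^ 2 - (x * cosh x - sinh x) ^ 3 / (x ^ 3 * sinh x))) x := by
    intro x hx
    have hs := (sinh_pos_iff.2 hx).ne'
    have hn := (sub_pos.2 (sinh_lt_mul_cosh hx)).ne'
    have hl : HasDerivAt langevin _ x := (hasDerivAt_mul_cosh_sub_sinh x).div
      ((hasDerivAt_id x).mul (hasDerivAt_sinh x)) (mul_ne_zero hx.ne' hs)
    refine ((((hasDerivAt_id x).const_mul 2).div hl (langevin_pos hx).ne').sub
      ((hasDerivAt_log_sinh_sub_log hx).const_mul 2)).congr_deriv ?_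
    simp only [id, langevin]
    generalize hN : x * cosh x - sinh x = n at *
    have hc : cosh x = (n + sinh x) / x := by rw [← hN]; field_simp; ring
    rw [hc]
    field_simp
    ring
  refine monotoneOn_Ioi_of_hasDerivAt_nonneg hd fun x hx => ?_
  exact mul_nonneg (by positivity) (langevin_cubic_nonneg hx)

/-! ### Exponent 2 for C, case r > 1, then exponent 1 + r for r ≤ 1. -/

theorem log_two_mul_cosh_pos (x : ℝ) : 0 < log (2 * cosh x) :=
  log_pos (by linarith [one_le_cosh x])

theorem log_two_mul_cosh_eq (x : ℝ) : log (2 * cosh x) = log 2 + log (cosh x) :=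
  log_mul two_ne_zero (cosh_pos x).ne'

theorem log_two_mul_cosh_eq_add (x : ℝ) :
    log (2 * cosh x) = x + log (1 + exp (-(2 * x))) := by
  have h : 2 * cosh x = exp x * (1 + exp (-(2 * x))) := by
    rw [cosh_eq, mul_add, ← exp_add]; ring_nf
  rw [h, log_mul (exp_pos x).ne' (by positivity), log_exp]

theorem log_two_mul_cosh_mul_tanh_lt {x : ℝ} (hx : 0 < x) : log (2 * cosh x) * tanh x < x := by
  have h1 : log (1 + exp (-(2 * x))) ≤ exp (-(2 * x)) := by
    have := log_le_sub_one_of_pos (show 0 < 1 + exp (-(2 * x)) by positivity)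
    linarith
  have hs := sinh_pos_iff.2 hx
  rw [tanh_eq_sinh_div_cosh, mul_div_assoc', div_lt_iff₀ (cosh_pos x), log_two_mul_cosh_eq_add]
  have h2 : exp (-(2 * x)) = exp (-x) * exp (-x) := by rw [← exp_add]; ring_nf
  have h3 : exp (-x) * sinh x = (1 - exp (-(2 * x))) / 2 := by
    rw [sinh_eq, h2]
    have : exp (-x) * exp x = 1 := by rw [← exp_add]; simp
    linear_combination this / 2
  have h4 : -(2 * x) + 1 < exp (-(2 * x)) := add_one_lt_exp (by linarith)
  have h5 : exp (-x) * sinh x < x := by linarith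
  have h6 : exp (-(2 * x)) * sinh x < exp (-x) * x := by
    rw [h2, mul_assoc]; exact mul_lt_mul_of_pos_left h5 (exp_pos _)
  have h7 : cosh x - sinh x = exp (-x) := cosh_sub_sinh x
  have h8 := mul_le_mul_of_nonneg_right h1 hs.le
  nlinarith

theorem strictMonoOn_sq_sub_sq_log_two_mul_cosh :
    StrictMonoOn (fun x => x ^ 2 - log (2 * cosh x) ^ 2) (Set.Ioi 0) := by
  have hd : ∀ x, 0 < x → HasDerivAt (fun x => x ^ 2 - log (2 * cosh x) ^ 2)
      (2 * (x - log (2 * cosh x) * tanh x)) x := by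
    intro x _
    have h1 : HasDerivAt (fun x => log (2 * cosh x)) (tanh x) x := by
      simp only [log_two_mul_cosh_eq]
      exact (hasDerivAt_log_cosh x).const_add _
    exact ((hasDerivAt_pow 2 x).sub (h1.pow 2)).congr_deriv (by norm_num; ring)
  exact strictMonoOn_Ioi_of_hasDerivAt_pos hd fun x hx =>
    mul_pos two_pos (sub_pos.2 (log_two_mul_cosh_mul_tanh_lt hx))

theorem two_mul_sq_lt_log_mul_log {u : ℝ} (hu : 0 < u) :
    2 * u ^ 2 < log (2 * cosh u) * log (2 * cosh (2 * u) - 1) := by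
  -- For small u, log (1 + t) ≥ 2t / (t + 2) at t = 4u² bounds the second factor below by 3u² (this
  -- needs u² ≤ 1/6), and 3 log 2 > 2.
  rcases le_total u (2 / 5) with h | h
  · have h1 : log 2 ≤ log (2 * cosh u) :=
      log_le_log two_pos (by linarith [one_le_cosh u])
    have h2 : 1 + 4 * u ^ 2 ≤ 2 * cosh (2 * u) - 1 := by
      rw [cosh_two_mul, cosh_sq]
      have := pow_le_pow_left₀ hu.le (self_lt_sinh_iff.2 hu).le 2
      linarith
    have h3 := le_log_one_add_of_nonneg (show 0 ≤ 4 * u ^ 2 by positivity)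
    have h4 := log_le_log (by positivity) h2
    have h5 := log_two_gt_d9
    have h6 : 3 * u ^ 2 ≤ 2 * (4 * u ^ 2) / (4 * u ^ 2 + 2) := by
      rw [le_div_iff₀ (by positivity)]
      have : u ^ 2 ≤ 4 / 25 := by nlinarith
      nlinarith [sq_nonneg u]
    have h7 : 0 < u ^ 2 := by positivity
    nlinarith [mul_le_mul h1 (h6.trans (h3.trans h4)) (by positivity) (log_two_mul_cosh_pos u).le]
  · set y := exp (-(2 * u)) with hy
    have hy0 : 0 < y := exp_pos _
    have e1 : 2 * cosh (2 * u) - 1 = exp (2 * u) * ((1 + y ^ 3) / (1 + y)) := by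
      have h1 : exp (2 * u) * y = 1 := by rw [hy, ← exp_add]; simp
      have h2 : (1 + y ^ 3) / (1 + y) = 1 - y + y ^ 2 := by field_simp; ring
      rw [h2, cosh_eq, ← hy]
      linear_combination (1 - y) * h1
    have e2 : log (2 * cosh (2 * u) - 1) = 2 * u + log (1 + y ^ 3) - log (1 + y) := by
      rw [e1, log_mul (exp_pos _).ne' (by positivity), log_exp,
        log_div (by positivity) (by positivity)]
      ring
    rw [e2, log_two_mul_cosh_eq_add, ← hy]
    -- With A = log (1 + y) and δ = log (1 + y³), the product is (u + A)(2u + δ - A) = 2u² + A(u -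
    -- A) + δ(u + A), so A ≤ u suffices.
    have ha : 0 < log (1 + y) := log_pos (by linarith)
    have hδ : 0 < log (1 + y ^ 3) := log_pos (by nlinarith [pow_pos hy0 3])
    have hau : log (1 + y) ≤ u := by
      rw [log_le_iff_le_exp (by positivity)]
      have h1 : u + 1 ≤ exp u := add_one_le_exp u
      have h2 : y * exp u ^ 2 = 1 := by
        rw [hy, ← exp_nat_mul, ← exp_add]; simp
      have h3 : 1 + u + u ^ 2 / 2 ≤ exp u := quadratic_le_exp_of_nonneg hu.le
      have h4 : (37 / 25 : ℝ) ≤ exp u := by nlinarith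
      nlinarith [mul_le_mul_of_nonneg_left h4 hy0.le]
    nlinarith

theorem exp_mul_cosh_two_mul_lt {u k w : ℝ} (hk : 0 < k) (hkw : k < w) (hw : k + w < u)
    (h : 2 * log (2 * cosh u) * k < u ^ 2 + k ^ 2 - w ^ 2) :
    exp (2 * k) * cosh (2 * w) < cosh (2 * u) := by
  have hu : 0 < u := by linarith
  set V := log (2 * cosh u) with hV
  have hVpos : 0 < V := log_two_mul_cosh_pos u
  -- The point k = w = q is where the curve e^(2k) cosh (2w) = cosh (2u) meets the diagonal.
  obtain ⟨q, hq⟩ : ∃ q, q = log (2 * cosh (2 * u) - 1) / 4 := ⟨_, rfl⟩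
  have hnum : u ^ 2 < 2 * V * q := by
    have := two_mul_sq_lt_log_mul_log hu
    rw [← hV] at this
    rw [hq]; linarith
  have hkq : k < q := by
    have : 2 * V * k < 2 * V * q := by nlinarith
    exact lt_of_mul_lt_mul_left this (by positivity)
  have hq0 : 0 < q := hk.trans hkq
  have hexp : exp (2 * q) * cosh (2 * q) = cosh (2 * u) := by
    have h1 : exp (4 * q) = 2 * cosh (2 * u) - 1 := by
      rw [hq, mul_div_cancel₀ _ four_ne_zero, exp_log]
      linarith [one_le_cosh (2 * u)]
    have h2 : exp (2 * q) * exp (2 * q) = exp (4 * q) := by rw [← exp_add]; ring_nf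
    have h3 : exp (2 * q) * exp (-(2 * q)) = 1 := by rw [← exp_add]; simp
    rw [cosh_eq]
    linear_combination h2 / 2 + h3 / 2 + h1 / 2
  have hlog : log (cosh (2 * q)) = log (cosh (2 * u)) - 2 * q := by
    rw [← hexp, log_mul (exp_pos _).ne' (cosh_pos _).ne', log_exp]; ring
  rcases le_or_gt w q with hwq | hwq
  · rw [← hexp]
    have h1 : exp (2 * k) < exp (2 * q) := exp_lt_exp.2 (by linarith)
    have h2 : cosh (2 * w) ≤ cosh (2 * q) := by
      rw [cosh_le_cosh, abs_of_pos (by linarith), abs_of_pos (by linarith)]; linarith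
    exact mul_lt_mul h1 h2 (cosh_pos _) (exp_pos _).le
  by_contra! hcon
  have hδ : log (cosh (2 * u)) - log (cosh (2 * w)) ≤ 2 * k := by
    have := log_le_log (cosh_pos _) hcon
    rw [log_mul (exp_pos _).ne' (cosh_pos _).ne', log_exp] at this
    linarith
  have hlc : ∀ x : ℝ, 0 < x → HasDerivAt (fun x => log (cosh x)) (tanh x) x :=
    fun x _ => hasDerivAt_log_cosh x
  obtain ⟨ξ, h1, h2, h3⟩ := exists_sq_sub_sq_eq hlc (fun x => tanh_pos_of_pos)
    (show 0 < 2 * q by linarith) (show 2 * q < 2 * w by linarith)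
  obtain ⟨ζ, h4, h5, h6⟩ := exists_sq_sub_sq_eq hlc (fun x => tanh_pos_of_pos)
    (show 0 < 2 * w by linarith) (show 2 * w < 2 * u by linarith)
  have hanti := strictAntiOn_sqSlope_log_cosh (show 0 < ξ by linarith)
    (show 0 < ζ by linarith) (h2.trans h4)
  rw [hlog] at h3
  set S := sqSlope (fun x => log (cosh x)) tanh ξ
  set T := sqSlope (fun x => log (cosh x)) tanh ζ
  set c := log (cosh (2 * u))
  set d := log (cosh (2 * w))
  have hcd : 0 < c - d := by
    refine sub_pos.2 (log_lt_log (cosh_pos _) ?_)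
    rw [cosh_lt_cosh, abs_of_pos (by linarith), abs_of_pos (by linarith)]; linarith
  have hdq : 0 < d - (c - 2 * q) := by
    refine sub_pos.2 (hlog ▸ log_lt_log (cosh_pos _) ?_)
    rw [cosh_lt_cosh, abs_of_pos (by linarith), abs_of_pos (by linarith)]; linarith
  -- the slope over `[2q, 2u]` exceeds the slope over `[2w, 2u]`
  have hA : q * (4 * u ^ 2 - 4 * w ^ 2 + (c - d) ^ 2) < 2 * (c - d) * u ^ 2 := by
    have h7 := mul_lt_mul_of_pos_left hanti (mul_pos hdq hcd)
    have h8 : (c - d) * (4 * w ^ 2 - 4 * q ^ 2) - (d - (c - 2 * q)) * (4 * u ^ 2 - 4 * w ^ 2)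
        = (d - (c - 2 * q)) * (c - d) * (S - T - 2 * q) := by
      linear_combination (c - d) * h3 - (d - (c - 2 * q)) * h6
    linarith
  -- The function t + 4(u² - w²)/t decreases up to t = 2k. Its value at 2k is bounded below by the
  -- hypothesis `h`, and c - d ≤ 2k.
  have hB : 4 * V * (c - d) ≤ 4 * u ^ 2 - 4 * w ^ 2 + (c - d) ^ 2 := by
    have hP : k ^ 2 < u ^ 2 - w ^ 2 := by nlinarith
    have h8 : 0 ≤ (2 * k - (c - d)) * (4 * (u ^ 2 - w ^ 2) - (c - d) * (2 * k)) :=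
      mul_nonneg (by linarith) (by nlinarith)
    have h9 : (c - d) * (2 * V * k) ≤ (c - d) * (u ^ 2 + k ^ 2 - w ^ 2) :=
      mul_le_mul_of_nonneg_left h.le hcd.le
    have : (2 * k) * (4 * V * (c - d)) ≤ (2 * k) * (4 * u ^ 2 - 4 * w ^ 2 + (c - d) ^ 2) := by
      linarith
    exact le_of_mul_le_mul_left this (by linarith)
  have : (c - d) * (2 * V * q) < (c - d) * u ^ 2 := by
    have := mul_le_mul_of_nonneg_left hB hq0.le
    linarith
  have := lt_of_mul_lt_mul_left this hcd.le
  linarith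

/-- The required bound on k comes from x² - log (2 cosh x)² increasing from u to ru, after division
by r² - 1. -/
theorem IsSqChord.exp_mul_cosh_lt_of_one_lt {u r k : ℝ} (hu : 0 < u) (hr : 1 < r)
    (h : IsSqChord (fun x => log (cosh x)) tanh u r k) :
    exp (2 * k) * cosh (2 * (k * r)) < cosh (2 * u) := by
  have hk := h.pos hu (by linarith) fun x => tanh_pos_of_pos
  refine exp_mul_cosh_two_mul_lt hk (by nlinarith) (h.lt hu fun x _ => tanh_lt_one x) ?_
  have h1 := strictMonoOn_sq_sub_sq_log_two_mul_cosh hu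
    (show 0 < r * u by positivity) (show u < r * u by nlinarith)
  have h2 : log (2 * cosh (r * u)) = log (2 * cosh u) + k * (r ^ 2 - 1) := by
    rw [log_two_mul_cosh_eq, log_two_mul_cosh_eq]; linarith [h.chord]
  simp only [h2] at h1
  have h3 : 0 < r ^ 2 - 1 := by nlinarith
  have : (r ^ 2 - 1) * (2 * log (2 * cosh u) * k)
      < (r ^ 2 - 1) * (u ^ 2 + k ^ 2 - (k * r) ^ 2) := by nlinarith
  exact lt_of_mul_lt_mul_left this h3.le

theorem IsSqChord.exp_mul_cosh_lt_of_le_one {u r k : ℝ} (hu : 0 < u) (hr : 0 < r) (hr1 : r ≤ 1)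
    (h : IsSqChord (fun x => log (cosh x)) tanh u r k) :
    exp ((1 + r) * k) * cosh ((1 + r) * (k * r)) < cosh ((1 + r) * u) := by
  obtain ⟨ξ, hξ, hξu, hd⟩ := h.exists_deriv
  have hv : 0 < r * u := by positivity
  obtain ⟨ζ, h1, _, h2⟩ := exists_slope_eq_deriv (show u < u + 2 * (r * u) by linarith)
    fun x _ _ => hasDerivAt_log_cosh x
  have hT := strictMono_tanh ((hξu hr1).trans_lt h1)
  -- Split at u: the part from ru to u gives k(1 - r²), and the rest is 2ru tanh ζ > 2ru tanh ξ =
  -- 2rk(1 + r).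
  have hlt : k * (1 + r) ^ 2 < log (cosh (u + 2 * (r * u))) - log (cosh (r * u)) := by
    have h3 := h.chord
    have h4 := mul_lt_mul_of_pos_right hT (show 0 < 2 * (r * u) by positivity)
    nlinarith
  have hE := exp_lt_exp.2 hlt
  rw [exp_sub, exp_log (cosh_pos _), exp_log (cosh_pos _), lt_div_iff₀ (cosh_pos _)] at hE
  have hF : exp (k * (1 - r ^ 2)) * cosh (r * u) = cosh u := by
    have h3 : k * (1 - r ^ 2) = log (cosh u) - log (cosh (r * u)) := by linarith [h.chord]
    rw [h3, exp_sub, exp_log (cosh_pos _), exp_log (cosh_pos _),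
      div_mul_cancel₀ _ (cosh_pos _).ne']
  have hG : 2 * (exp ((1 + r) * k) * cosh ((1 + r) * (k * r)))
      = exp (k * (1 + r) ^ 2) + exp (k * (1 - r ^ 2)) := by
    rw [cosh_eq, mul_div_assoc', mul_div_cancel₀ _ two_ne_zero, mul_add, ← exp_add, ← exp_add]
    ring_nf
  have hH : 2 * cosh ((1 + r) * u) * cosh (r * u) = cosh (u + 2 * (r * u)) + cosh u := by
    have e1 : u + 2 * (r * u) = (1 + r) * u + r * u := by ring
    have e2 : u = (1 + r) * u - r * u := by ring
    rw [e1, cosh_add]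
    conv_rhs => rw [e2, cosh_sub]
    ring_nf
  have : 2 * (exp ((1 + r) * k) * cosh ((1 + r) * (k * r))) * cosh (r * u)
      < 2 * cosh ((1 + r) * u) * cosh (r * u) := by
    rw [hH, hG]; linarith
  have := lt_of_mul_lt_mul_right this (cosh_pos _).le
  linarith

/-! ### Changing the exponent by concavity and convexity. -/

theorem exists_convex_weights {a b x : ℝ} (hab : a < b) (hax : a ≤ x) (hxb : x ≤ b) :
    ∃ s t : ℝ, 0 ≤ s ∧ 0 ≤ t ∧ s + t = 1 ∧ s * a + t * b = x ∧ t * a + s * b = a + b - x := by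
  have h : 0 < b - a := sub_pos.2 hab
  refine ⟨(b - x) / (b - a), (x - a) / (b - a), div_nonneg (by linarith) h.le,
    div_nonneg (by linarith) h.le, ?_, ?_, ?_⟩ <;> field_simp <;> ring

theorem rpow_add_rpow_lt_of_le_one {a b x y α : ℝ} (ha : 0 < a) (hab : a < b) (hax : a ≤ x)
    (hxb : x ≤ b) (h : a + b < x + y) (hα : 0 < α) (hα1 : α ≤ 1) :
    a ^ α + b ^ α < x ^ α + y ^ α := by
  obtain ⟨s, t, hs, ht, hst, h1, h2⟩ := exists_convex_weights hab hax hxb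
  have hc := (concaveOn_rpow hα.le hα1).2
  have hb := ha.trans hab
  have e1 := hc (show a ∈ Set.Ici 0 from ha.le) (show b ∈ Set.Ici 0 from hb.le) hs ht hst
  have e2 := hc (show a ∈ Set.Ici 0 from ha.le) (show b ∈ Set.Ici 0 from hb.le) ht hs
    (by linarith)
  simp only [smul_eq_mul, h1, h2] at e1 e2
  have e3 : (a + b - x) ^ α < y ^ α := rpow_lt_rpow (by linarith) (by linarith) hα
  have e4 : a ^ α + b ^ α = (s + t) * a ^ α + (s + t) * b ^ α := by rw [hst]; ring
  linarith

theorem rpow_add_rpow_lt_of_one_le {a b x y p : ℝ} (ha : 0 < a) (hab : a < b) (hax : a ≤ x)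
    (hxb : x ≤ b) (hy : 0 ≤ y) (h : x + y < a + b) (hp : 1 ≤ p) :
    x ^ p + y ^ p < a ^ p + b ^ p := by
  obtain ⟨s, t, hs, ht, hst, h1, h2⟩ := exists_convex_weights hab hax hxb
  have hc := (convexOn_rpow hp).2
  have hb := ha.trans hab
  have e1 := hc (show a ∈ Set.Ici 0 from ha.le) (show b ∈ Set.Ici 0 from hb.le) hs ht hst
  have e2 := hc (show a ∈ Set.Ici 0 from ha.le) (show b ∈ Set.Ici 0 from hb.le) ht hs
    (by linarith)
  simp only [smul_eq_mul, h1, h2] at e1 e2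
  have e3 : y ^ p < (a + b - x) ^ p := rpow_lt_rpow hy (by linarith) (by linarith)
  have e4 : a ^ p + b ^ p = (s + t) * a ^ p + (s + t) * b ^ p := by rw [hst]; ring
  linarith

/-! ### Sums of powers and means in exponential coordinates. -/

theorem exp_add_add_exp_sub (g u : ℝ) : exp (g + u) + exp (g - u) = exp g * (2 * cosh u) := by
  rw [cosh_eq, exp_add, sub_eq_add_neg, exp_add]; ring

theorem exp_add_sub_exp_sub (g u : ℝ) : exp (g + u) - exp (g - u) = exp g * (2 * sinh u) := by
  rw [sinh_eq, exp_add, sub_eq_add_neg g u, exp_add]; ring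

/-- The hypothesis is the case of exponent γ; the convex power p / γ ≥ 1 lifts it to p. -/
theorem exp_rpow_add_exp_rpow_lt {g u k w p γ : ℝ} (hk : 0 < k) (hw : 0 < w) (hkw : k + w < u)
    (hγ : 0 < γ) (hγp : γ ≤ p) (h : exp (γ * k) * cosh (γ * w) < cosh (γ * u)) :
    exp (g + k + w) ^ p + exp (g + k - w) ^ p < exp (g - u) ^ p + exp (g + u) ^ p := by
  have key : ∀ t, exp t ^ p = exp (γ * t) ^ (p / γ) := by
    intro t
    rw [← exp_mul, ← exp_mul]
    congr 1; field_simp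
  simp only [key]
  refine rpow_add_rpow_lt_of_one_le (exp_pos _) (exp_lt_exp.2 ?_) (exp_le_exp.2 ?_)
    (exp_le_exp.2 ?_) (exp_pos _).le ?_ ((one_le_div hγ).2 hγp)
  · exact mul_lt_mul_of_pos_left (by linarith) hγ
  · exact mul_le_mul_of_nonneg_left (by linarith) hγ.le
  · exact mul_le_mul_of_nonneg_left (by linarith) hγ.le
  · rw [add_comm (exp (γ * (g - u))), mul_add γ (g + k), mul_sub γ (g + k), exp_add_add_exp_sub,
      mul_add γ g u, mul_sub γ g u, exp_add_add_exp_sub, mul_add, exp_add, mul_assoc]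
    refine mul_lt_mul_of_pos_left ?_ (exp_pos _)
    linarith

theorem lt_exp_rpow_add_exp_rpow {g u k w α : ℝ} (hk : 0 < k) (hw : 0 < w) (hkw : k + w < u)
    (hα : 0 < α) (hα1 : α ≤ 1) (h : cosh u < exp k * cosh w) :
    exp (g - u) ^ α + exp (g + u) ^ α < exp (g + k + w) ^ α + exp (g + k - w) ^ α := by
  refine rpow_add_rpow_lt_of_le_one (exp_pos _) (exp_lt_exp.2 (by linarith))
    (exp_le_exp.2 (by linarith)) (exp_le_exp.2 (by linarith)) ?_ hα hα1
  rw [add_comm (exp (g - u)), exp_add_add_exp_sub, exp_add_add_exp_sub, exp_add, mul_assoc]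
  refine mul_lt_mul_of_pos_left ?_ (exp_pos _)
  linarith

theorem exp_rpow_add_div_exp_add (g u s : ℝ) :
    (exp (g + u) ^ s + exp (g - u) ^ s) / (exp (g + u) + exp (g - u))
      = exp (g * (s - 1) + (log (cosh (s * u)) - log (cosh u))) := by
  have hc := (cosh_pos u).ne'
  rw [← exp_mul, ← exp_mul, add_mul, sub_mul, exp_add_add_exp_sub, exp_add_add_exp_sub,
    exp_add, exp_sub, exp_log (cosh_pos _), exp_log (cosh_pos _), mul_sub, mul_one, exp_sub,
    mul_comm u s]
  field_simp

theorem genInvHarmMean_exp {g u r k : ℝ}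
    (h : IsSqChord (fun x => log (cosh x)) tanh u r k) :
    genInvHarmMean r (exp (g - u)) (exp (g + u)) = exp (g + k + k * r) := by
  unfold genInvHarmMean
  split_ifs with h1
  · have hs : exp (g + u) + exp (g - u) ≠ 0 := by positivity
    have h2 := h.confluent h1
    have hc := (cosh_pos u).ne'
    rw [← exp_mul, ← exp_mul, ← exp_add, ← exp_mul]
    congr 1
    have e : (g + u) * exp (g + u) + (g - u) * exp (g - u)
        = (exp (g + u) + exp (g - u)) * (g + u * tanh u) := by
      have e1 := exp_add_add_exp_sub g u
      have e2 := exp_add_sub_exp_sub g u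
      have e3 : cosh u * tanh u = sinh u := by rw [tanh_eq_sinh_div_cosh]; field_simp
      linear_combination u * e2 - u * tanh u * e1 - 2 * u * exp g * e3
    rw [e, h1, mul_one, mul_one_div, mul_div_cancel_left₀ _ hs]
    linear_combination -h2
  · rw [exp_rpow_add_div_exp_add, ← exp_mul]
    congr 1
    have : r - 1 ≠ 0 := sub_ne_zero.2 h1
    rw [mul_one_div, div_eq_iff this]
    linear_combination h.chord

theorem genInvHarmMean_neg_exp {g u r k : ℝ} (hr : 0 < r)
    (h : IsSqChord (fun x => log (cosh x)) tanh u r k) :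
    genInvHarmMean (-r) (exp (g - u)) (exp (g + u)) = exp (g + k - k * r) := by
  unfold genInvHarmMean
  rw [if_neg (by linarith), exp_rpow_add_div_exp_add, ← exp_mul, neg_mul, cosh_neg]
  congr 1
  have : -r - 1 ≠ 0 := by linarith
  rw [mul_one_div, div_eq_iff this]
  linear_combination h.chord

theorem exp_rpow_sub_div_exp_sub {g u s : ℝ} (hu : 0 < u) (hs : s ≠ 0) :
    (exp (g + u) ^ s - exp (g - u) ^ s) / (s * (exp (g + u) - exp (g - u)))
      = exp (g * (s - 1)) * (sinh (s * u) / (s * u) / (sinh u / u)) := by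
  have hc := (sinh_pos_iff.2 hu).ne'
  rw [← exp_mul, ← exp_mul, add_mul, sub_mul, exp_add_sub_exp_sub, exp_add_sub_exp_sub,
    mul_sub, mul_one, exp_sub, mul_comm u s]
  field_simp

theorem sinh_div_div_eq_exp {u r : ℝ} (hu : 0 < u) (hr : 0 < r) :
    sinh (r * u) / (r * u) / (sinh u / u)
      = exp (log (sinh (r * u)) - log (r * u) - (log (sinh u) - log u)) := by
  have h1 := sinh_pos_iff.2 hu
  have hv := mul_pos hr hu
  have h2 := sinh_pos_iff.2 hv
  rw [exp_sub, exp_sub, exp_sub, exp_log h1, exp_log hu, exp_log h2, exp_log hv]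

theorem genLogMean_exp {g u r k : ℝ} (hu : 0 < u) (hr : 0 < r)
    (h : IsSqChord (fun x => log (sinh x) - log x) langevin u r k) :
    genLogMean r (exp (g - u)) (exp (g + u)) = exp (g + k + k * r) := by
  have hlt : exp (g - u) < exp (g + u) := exp_lt_exp.2 (by linarith)
  unfold genLogMean
  rw [if_neg hlt.ne, if_neg hr.ne']
  split_ifs with h1
  · have hs : exp (g + u) - exp (g - u) ≠ 0 := (sub_pos.2 hlt).ne'
    have h2 := h.confluent h1
    rw [← exp_mul, ← exp_mul, ← exp_sub, ← exp_mul, one_div, ← exp_neg, ← exp_add]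
    congr 1
    have e : (g + u) * exp (g + u) - (g - u) * exp (g - u)
        = (exp (g + u) - exp (g - u)) * (g + (1 + u * langevin u)) := by
      have e1 := exp_add_add_exp_sub g u
      have e2 := exp_add_sub_exp_sub g u
      have hs := (sinh_pos_iff.2 hu).ne'
      have e3 : sinh u * (1 + u * langevin u) = u * cosh u := by
        unfold langevin; field_simp; ring
      linear_combination u * e1 - (1 + u * langevin u) * e2 - 2 * exp g * e3
    rw [e, h1, mul_one, mul_one_div, mul_div_cancel_left₀ _ hs]
    linear_combination -h2
  · rw [exp_rpow_sub_div_exp_sub hu hr.ne', sinh_div_div_eq_exp hu hr, ← exp_add, ← exp_mul]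
    congr 1
    have : r - 1 ≠ 0 := sub_ne_zero.2 h1
    rw [mul_one_div, div_eq_iff this]
    linear_combination h.chord

theorem genLogMean_neg_exp {g u r k : ℝ} (hu : 0 < u) (hr : 0 < r)
    (h : IsSqChord (fun x => log (sinh x) - log x) langevin u r k) :
    genLogMean (-r) (exp (g - u)) (exp (g + u)) = exp (g + k - k * r) := by
  have hlt : exp (g - u) < exp (g + u) := exp_lt_exp.2 (by linarith)
  unfold genLogMean
  rw [if_neg hlt.ne, if_neg (by linarith), if_neg (by linarith),
    exp_rpow_sub_div_exp_sub hu (by linarith), neg_mul, sinh_neg, neg_div_neg_eq,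
    sinh_div_div_eq_exp hu hr, ← exp_add, ← exp_mul]
  congr 1
  have : -r - 1 ≠ 0 := by linarith
  rw [mul_one_div, div_eq_iff this]
  linear_combination h.chord

/-! ### Exponent 1 for both means, and the conclusion. -/

theorem IsSqChord.cosh_lt_exp_mul_cosh {u r k : ℝ} (hu : 0 < u) (hr : 0 < r)
    (h : IsSqChord (fun x => log (cosh x)) tanh u r k) : cosh u < exp k * cosh (k * r) := by
  have := h.sub_lt_of_strictAntiOn (fun x _ => hasDerivAt_log_cosh x)
    (fun x => tanh_pos_of_pos) (fun x _ => tanh_lt_one x) strictAntiOn_sqSlope_log_cosh hu hr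
  rw [← log_lt_log_iff (cosh_pos _) (by positivity),
    log_mul (exp_pos _).ne' (cosh_pos _).ne', log_exp]
  linarith

theorem IsSqChord.exp_mul_cosh_lt_of_langevin {u r k : ℝ} (hu : 0 < u) (hr : 0 < r)
    (h : IsSqChord (fun x => log (sinh x) - log x) langevin u r k) :
    exp k * cosh (k * r) < cosh u := by
  have hk := h.pos hu hr fun x => langevin_pos
  have hkw := h.lt hu fun x => langevin_lt_one
  have hw : 0 < k * r := mul_pos hk hr
  have h1 := h.le_sub_of_monotoneOn (fun x => hasDerivAt_log_sinh_sub_log)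
    (fun x => langevin_pos) (fun x => langevin_lt_one) monotoneOn_sqSlope_log_sinh_sub_log hu hr
  -- `x * coth x` is increasing
  have hd : ∀ x, 0 < x → HasDerivAt (fun x => log (cosh x) - (log (sinh x) - log x))
      (tanh x - langevin x) x := fun x hx =>
    (hasDerivAt_log_cosh x).sub (hasDerivAt_log_sinh_sub_log hx)
  have h2 := strictMonoOn_Ioi_of_hasDerivAt_pos hd (fun x hx => by
    have hs := sinh_pos_iff.2 hx
    have hc := cosh_pos x
    rw [sub_pos, langevin, tanh_eq_sinh_div_cosh, div_lt_div_iff₀ (by positivity) hc]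
    have h3 : sinh x * cosh x > x := by
      have := self_lt_sinh_iff.2 (show 0 < 2 * x by linarith)
      rw [sinh_two_mul] at this
      linarith
    have h4 := cosh_sq x
    nlinarith) hw hu (show k * r < u by linarith)
  simp only at h1 h2
  rw [← log_lt_log_iff (by positivity) (cosh_pos _),
    log_mul (exp_pos _).ne' (cosh_pos _).ne', log_exp]
  linarith

theorem corollary6p3 (r a b : ℝ) (hr : 0 < r) (ha : 0 < a) (hab : a < b) :
    (∀ α : ℝ, 0 < α → α ≤ 1 →
      genInvHarmMean r a b ^ α + genInvHarmMean (-r) a b ^ α > a ^ α + b ^ α) ∧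
    (∀ β : ℝ, 0 ≤ β →
      genInvHarmMean r a b ^ (2 + β) + genInvHarmMean (-r) a b ^ (2 + β)
        < a ^ (2 + β) + b ^ (2 + β)) ∧
    (∀ β : ℝ, 0 ≤ β →
      genLogMean r a b ^ (1 + β) + genLogMean (-r) a b ^ (1 + β)
        < a ^ (1 + β) + b ^ (1 + β)) := by

  obtain ⟨g, u, hu, rfl, rfl⟩ : ∃ g u, 0 < u ∧ a = exp (g - u) ∧ b = exp (g + u) := by
    have hb := ha.trans hab
    refine ⟨(log a + log b) / 2, (log b - log a) / 2, ?_, ?_, ?_⟩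
    · linarith [log_lt_log ha hab]
    · rw [← exp_log ha]; ring_nf; simp
    · rw [← exp_log hb]; ring_nf; simp
  obtain ⟨k, hk⟩ := exists_isSqChord (fun x _ => hasDerivAt_log_cosh x)
    (fun x => tanh_pos_of_pos) hu hr
  obtain ⟨l, hl⟩ := exists_isSqChord (fun x => hasDerivAt_log_sinh_sub_log)
    (fun x => langevin_pos) hu hr
  have hk0 := hk.pos hu hr fun x => tanh_pos_of_pos
  have hku := hk.lt hu fun x _ => tanh_lt_one x
  have hl0 := hl.pos hu hr fun x => langevin_pos
  have hlu := hl.lt hu fun x => langevin_lt_one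
  rw [genInvHarmMean_exp hk, genInvHarmMean_neg_exp hr hk, genLogMean_exp hu hr hl,
    genLogMean_neg_exp hu hr hl]
  refine ⟨fun α hα hα1 => ?_, fun β hβ => ?_, fun β hβ => ?_⟩
  · exact lt_exp_rpow_add_exp_rpow hk0 (mul_pos hk0 hr) hku hα hα1
      (hk.cosh_lt_exp_mul_cosh hu hr)
  · rcases le_or_gt r 1 with h | h
    -- Here γ = 1 + r, which is at most 2 ≤ 2 + β.
    · exact exp_rpow_add_exp_rpow_lt hk0 (mul_pos hk0 hr) hku (by linarith) (by linarith)
        (hk.exp_mul_cosh_lt_of_le_one hu hr h)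
    · exact exp_rpow_add_exp_rpow_lt hk0 (mul_pos hk0 hr) hku two_pos (by linarith)
        (hk.exp_mul_cosh_lt_of_one_lt hu h)
  · refine exp_rpow_add_exp_rpow_lt hl0 (mul_pos hl0 hr) hlu one_pos (by linarith) ?_
    simpa only [one_mul] using hl.exp_mul_cosh_lt_of_langevin hu hr
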